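/- Let $X$ be a real Banach space with $\dim X\ge 2$. Put \[\delta_X(\epsilon)=\inf\{1-\tfrac12\|x+y\| : \|x\|=\|y\|=1,\ \|x-y\|=\epsilon\}\quad(0\le\epsilon\le 2),\] \[\rho_X(\tau)=\sup\{\tfrac12(\|x+y\|+\|x-y\|)-1 : \|x\|=1,\ \|y\|=\tau\}\quad(\tau>0).\] Assume that $X$ is uniformly convex and uniformly smooth, both moduli being of power type $2$: there are constants $K,M>0$ with $\delta_X(\epsilon)\ge M\epsilon^2$ for $0<\epsilon\le 2$ and $\rho_X(\tau)\le K\tau^2$ for $\tau>0$. Let $\Omega=X\setminus\{0\}$ and $d(x)=\operatorname{dist}(x,\partial\Omega)=\|x\|$. For a path $\gamma\colon[0,T]\to X$ let $\ell_{\|\cdot\|}(\gamma,a,b)$ be the norm length of $\gamma|_{[a,b]}$ (the supremum of $\sum_i\|\gamma(s_{i+1})-\gamma(s_i)\|$ over partitions of $[a,b]$) and $\ell_{\|\cdot\|}(\gamma)=\ell_{\|\cdot\|}(\gamma,0,T)$; $\gamma$ is rectifiable if it is continuous and $\ell_{\|\cdot\|}(\gamma)<\infty$. Its length element is $\|D\gamma(s)\|=\frac{d}{ds}\ell_{\|\cdot\|}(\gamma,0,s)$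 for a.e. $s$. If $s\mapsto\ell_{\|\cdot\|}(\gamma,0,s)$ is absolutely continuous and $\gamma$ takes values in $\Omega$, its quasihyperbolic length is $\ell_k(\gamma)=\int_0^T\frac{\|D\gamma(s)\|}{d(\gamma(s))}\,ds$. Theorem. There is $R>0$, depending only on $X$, such that the following holds. Let $0\le t_1\le t_2$ and let $\gamma_1,\gamma_2\colon[0,t_2]\to\Omega$ be rectifiable paths such that (i) $\gamma_1$, $\gamma_2$ and $(\gamma_1+\gamma_2)/2$ take values in $\{x\in X: 1\le\|x\|\le 2\}$; (ii) $\gamma_1(0)=\gamma_2(0)$; (iii) $\max(\ell_k(\gamma_1),\ell_k(\gamma_2))\le R$; (iv) $\ell_{\|\cdot\|}(\gamma_1)=t_1$ and $\ell_{\|\cdot\|}(\gamma_2)=t_2$; (v) $\gamma_1$ is parametrized by norm arc length on $[0,t_1]$ and $\gamma_1(t)=\gamma_1(t_1)$ for $t\in[t_1,t_2]$, and $\gamma_2$ is parametrized by norm arc length on $[0,t_2]$. Then \[\frac{\ell_k(\gamma_1)+\ell_k(\gamma_2)}{2}+\int_{t_1}^{t_2}\frac{\|D\gamma_2(s)\|}{2\,d(\gamma_2(s))}\,ds\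 \ge\ \ell_k\Big(\frac{\gamma_1+\gamma_2}{2}\Big)+\int_0^{t_1}\frac{\delta_X\big(\|D(\gamma_1-\gamma_2)(s)\|\big)}{\|\gamma_1(s)\|+\|\gamma_2(s)\|}\,ds .\] -/

import Mathlib

open Set MeasureTheory
open scoped ENNReal

noncomputable section

namespace QuasihyperbolicPaths

/-- The modulus of convexity
`δ_X(ε) = inf {1 - ‖x + y‖ / 2 : ‖x‖ = ‖y‖ = 1, ‖x - y‖ = ε}`.
If `dim X ≥ 2` the set is nonempty for `0 ≤ ε ≤ 2`, and it is bounded below by `0`;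
in particular `δ_X(0) = 0`. -/
def modulusOfConvexity (X : Type*) [NormedAddCommGroup X] [NormedSpace ℝ X] (ε : ℝ) : ℝ :=
  sInf {r : ℝ | ∃ x y : X, ‖x‖ = 1 ∧ ‖y‖ = 1 ∧ ‖x - y‖ = ε ∧ r = 1 - ‖x + y‖ / 2}

/-- The modulus of smoothness
`ρ_X(τ) = sup {(‖x + y‖ + ‖x - y‖) / 2 - 1 : ‖x‖ = 1, ‖y‖ = τ}`; the set is bounded above
by `τ`. -/
def modulusOfSmoothness (X : Type*) [NormedAddCommGroup X] [NormedSpace ℝ X] (τ : ℝ) : ℝ :=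
  sSup {r : ℝ | ∃ x y : X, ‖x‖ = 1 ∧ ‖y‖ = τ ∧ r = (‖x + y‖ + ‖x - y‖) / 2 - 1}

/-- `X` is uniformly convex of power type `p`: `δ_X(ε) ≥ K ε ^ p` for some `K > 0`. -/
def UniformlyConvexOfPowerType (X : Type*) [NormedAddCommGroup X] [NormedSpace ℝ X]
    (p : ℝ) : Prop :=
  ∃ K : ℝ, 0 < K ∧ ∀ ε : ℝ, 0 < ε → ε ≤ 2 → K * ε ^ p ≤ modulusOfConvexity X ε

/-- `X` is uniformly smooth of power type `p`: `ρ_X(τ) ≤ K τ ^ p` for some `K > 0`. -/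
def UniformlySmoothOfPowerType (X : Type*) [NormedAddCommGroup X] [NormedSpace ℝ X]
    (p : ℝ) : Prop :=
  ∃ K : ℝ, 0 < K ∧ ∀ τ : ℝ, 0 < τ → modulusOfSmoothness X τ ≤ K * τ ^ p

/-- The norm length `ℓ_‖·‖(γ, a, b)` of `γ` restricted to `[a, b]`, the supremum of the sums
`∑ ‖γ (t_{i+1}) - γ (t_i)‖` over the partitions of `[a, b]`. -/
def pathLength {X : Type*} [NormedAddCommGroup X] (γ : ℝ → X) (a b : ℝ) : ℝ≥0∞ :=
  eVariationOn γ (Icc a b)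

/-- The restriction of `γ` to `[0, T]` is a rectifiable path in `Ω`. The values of `γ` outside
`[0, T]` play no role. -/
structure IsRectifiablePath {X : Type*} [NormedAddCommGroup X] (Ω : Set X) (T : ℝ)
    (γ : ℝ → X) : Prop where
  continuousOn : ContinuousOn γ (Icc 0 T)
  mapsTo : MapsTo γ (Icc 0 T) Ω
  length_ne_top : pathLength γ 0 T ≠ ∞

/-- The length element `‖Dγ(s)‖ = d/ds ℓ_‖·‖(γ, 0, s)` of a rectifiable path that is defined on an
interval `[0, T]`. It exists for almost every `s` in `[0, T]`. -/
def lengthElement {X : Type*} [NormedAddCommGroup X] (γ : ℝ → X) (s : ℝ) : ℝ :=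
  deriv (fun r : ℝ => (pathLength γ 0 r).toReal) s

/-- The distance `d(x) = d(x, ∂Ω)` of `x` to the boundary of `Ω`. -/
def boundaryDist {X : Type*} [NormedAddCommGroup X] (Ω : Set X) (x : X) : ℝ :=
  Metric.infDist x (frontier Ω)

/-- The quasihyperbolic length
`ℓ_k(γ, a, b) = ∫_a^b ‖dγ‖ / d(γ)`, with `‖dγ‖ = ‖Dγ‖ ds`, of a path in `Ω` whose length function
`s ↦ ℓ_‖·‖(γ, 0, s)` is absolutely continuous. -/
def qhLength {X : Type*} [NormedAddCommGroup X] (Ω : Set X) (γ : ℝ → X) (a b : ℝ) : ℝ≥0∞ :=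
  ∫⁻ s in Icc a b, ENNReal.ofReal (lengthElement γ s) / ENNReal.ofReal (boundaryDist Ω (γ s))

end QuasihyperbolicPaths

end

/-! The proof compares length elements pointwise and absorbs the one bad term by a Poincaré
inequality. Let `u`, `v` be the unit derivatives of the two paths at a time before `t₁`, and `a`,
`b` their positions. Uniform convexity makes the midpoint speed at most `1 - δ(‖u - v‖)`. Uniform
smoothness makes the reciprocal norm of the midpoint at most the mean of the reciprocals plus `K/4 *
‖a - b‖ ^ 2`. The gain contains two copies of `δ(‖u - v‖) / (‖a‖ + ‖b‖)`: one appears in the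
theorem, the other is at least `M/4 * ‖u - v‖ ^ 2` (`norm_midpoint_div_add_modulus_le`). Since the
paths start at the same point, Cauchy–Schwarz bounds the integral of `K * ‖γ₁ - γ₂‖ ^ 2` by `K * t₁
^ 2` times that of `‖(γ₁ - γ₂)'‖ ^ 2` (`lintegral_sq_norm_sub_le`). The spare gain pays for the loss
once `K * t₁ ^ 2 ≤ M`, which small quasihyperbolic length guarantees. After `t₁` the first path
rests and a crude norm estimate suffices. Derivatives exist almost everywhere because unit speed
forces difference quotients into thin slices of a uniformly convex ball
(`ae_differentiableAt_of_le_eVariationOn`). Their norms are the length elements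
(`ae_lengthElement_eq_norm_deriv`). -/

namespace QuasihyperbolicPaths

open Filter Topology

/-! ### Variation and length elements of Lipschitz paths -/

section Variation

variable {X : Type*} [NormedAddCommGroup X]

theorem eVariationOn_Icc_le_of_norm_sub_le {γ : ℝ → X} {Φ : ℝ → ℝ} {a b : ℝ} (hab : a ≤ b)
    (h : ∀ x y, a ≤ x → x ≤ y → y ≤ b → ‖γ y - γ x‖ ≤ Φ y - Φ x) :
    eVariationOn γ (Icc a b) ≤ ENNReal.ofReal (Φ b - Φ a) := by
  have hmono : MonotoneOn Φ (Icc a b) := fun x hx y hy hxy => by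
    have := (norm_nonneg _).trans (h x y hx.1 hxy hy.2)
    linarith
  calc eVariationOn γ (Icc a b) ≤ eVariationOn Φ (Icc a b) := by
        refine iSup_le fun p => ?_
        refine le_trans (Finset.sum_le_sum fun i _ => ?_) (eVariationOn.sum_le p.2.2.1 p.2.2.2)
        have hi := h _ _ (p.2.2.2 i).1 (p.2.2.1 (Nat.le_succ i)) (p.2.2.2 (i + 1)).2
        rw [edist_dist, edist_dist, dist_eq_norm, dist_eq_norm]
        exact ENNReal.ofReal_le_ofReal (hi.trans (Real.le_norm_self _))
    _ ≤ ENNReal.ofReal (Φ b - Φ a) := by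
        have := hmono.eVariationOn_eq (left_mem_Icc.2 hab) (right_mem_Icc.2 hab)
        rw [inter_self] at this
        exact this.le

theorem lengthElement_congr {γ Γ : ℝ → X} {T s : ℝ} (h : EqOn γ Γ (Icc 0 T)) (hs : s ∈ Ioo 0 T) :
    lengthElement γ s = lengthElement Γ s := by
  refine Filter.EventuallyEq.deriv_eq ?_
  filter_upwards [Iio_mem_nhds hs.2] with r hr
  simp only [pathLength]
  rw [eVariationOn.congr (h.mono (Icc_subset_Icc_right (le_of_lt hr)))]

variable [NormedSpace ℝ X]

theorem intervalIntegrable_norm_deriv [CompleteSpace X] {γ : ℝ → X} {K : NNReal}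
    (hL : LipschitzWith K γ) (a b : ℝ) :
    IntervalIntegrable (fun s => ‖deriv γ s‖) volume a b := by
  borelize X
  refine (intervalIntegrable_const (c := (K : ℝ))).mono_fun
    ((measurable_deriv γ).norm.aestronglyMeasurable) (Eventually.of_forall fun s => ?_)
  simp only [norm_norm]
  exact (norm_deriv_le_of_lipschitz hL).trans (Real.le_norm_self _)

/-- A functional norming the increment reduces this to the fundamental theorem of calculus for a
real Lipschitz function, which is absolutely continuous. -/
theorem norm_sub_le_integral_norm_deriv [CompleteSpace X] {γ : ℝ → X} {K : NNReal}
    (hL : LipschitzWith K γ) {a b : ℝ} (hab : a ≤ b)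
    (hd : ∀ᵐ s, s ∈ Ioo a b → DifferentiableAt ℝ γ s) :
    ‖γ b - γ a‖ ≤ ∫ s in a..b, ‖deriv γ s‖ := by
  obtain ⟨f, hf, hfx⟩ := exists_dual_vector'' ℝ (γ b - γ a)
  have hL' : LipschitzWith (‖f‖₊ * K) (fun s => f (γ s)) := f.lipschitz.comp hL
  have hac := (hL'.lipschitzOnWith (s := uIcc a b)).absolutelyContinuousOnInterval
  have hint := hac.integral_deriv_eq_sub
  calc ‖γ b - γ a‖ = ∫ s in a..b, deriv (fun s => f (γ s)) s := by
        rw [hint, ← map_sub, hfx]; rfl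
    _ ≤ ∫ s in a..b, ‖deriv γ s‖ := by
        refine intervalIntegral.integral_mono_ae_restrict hab hac.intervalIntegrable_deriv
          (intervalIntegrable_norm_deriv hL a b) ?_
        rw [← restrict_Ioo_eq_restrict_Icc]
        refine (ae_restrict_iff' measurableSet_Ioo).2 ?_
        filter_upwards [hd] with s hs hsm
        have := (f.hasFDerivAt (x := γ s)).comp_hasDerivAt s (hs hsm).hasDerivAt
        have h2 : deriv (fun s => f (γ s)) s = f (deriv γ s) := this.deriv
        rw [h2]
        exact (Real.le_norm_self _).trans (f.le_of_opNorm_le hf _ |>.trans (by simp))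

/-- The increments of the length function lie between the chord and the integral of `‖deriv γ‖`. At
a differentiability point that is also a Lebesgue point of this integral, both outer slopes tend to
`‖deriv γ s‖`. -/
theorem ae_lengthElement_eq_norm_deriv [CompleteSpace X] {γ : ℝ → X} {K : NNReal} {T : ℝ}
    (hL : LipschitzWith K γ) (hd : ∀ᵐ s, s ∈ Ioo 0 T → DifferentiableAt ℝ γ s) :
    ∀ᵐ s, s ∈ Ioo 0 T → lengthElement γ s = ‖deriv γ s‖ := by
  rcases le_or_gt T 0 with hT | hT
  · filter_upwards with s hs using absurd (hs.1.trans hs.2) hT.not_gt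
  set Φ : ℝ → ℝ := fun r => ∫ s in (0 : ℝ)..r, ‖deriv γ s‖ with hΦ
  set L : ℝ → ℝ := fun r => (pathLength γ 0 r).toReal with hLdef
  have hsub (x y : ℝ) : Φ y - Φ x = ∫ s in x..y, ‖deriv γ s‖ :=
    intervalIntegral.integral_interval_sub_left (intervalIntegrable_norm_deriv hL _ _)
      (intervalIntegrable_norm_deriv hL _ _)
  have hnorm : ∀ x y, 0 ≤ x → x ≤ y → y ≤ T → ‖γ y - γ x‖ ≤ Φ y - Φ x := fun x y hx hxy hy => by
    rw [hsub]
    refine norm_sub_le_integral_norm_deriv hL hxy ?_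
    filter_upwards [hd] with s hs hsm using hs ⟨hx.trans_lt hsm.1, hsm.2.trans_le hy⟩
  have hvar : ∀ x y, 0 ≤ x → x ≤ y → y ≤ T →
      eVariationOn γ (Icc x y) ≤ ENNReal.ofReal (Φ y - Φ x) := fun x y hx hxy hy =>
    eVariationOn_Icc_le_of_norm_sub_le hxy fun u v hu huv hv =>
      hnorm u v (hx.trans hu) huv (hv.trans hy)
  have hfin : ∀ x y, 0 ≤ x → x ≤ y → y ≤ T → eVariationOn γ (Icc x y) ≠ ∞ :=
    fun x y hx hxy hy => ((hvar x y hx hxy hy).trans_lt ENNReal.ofReal_lt_top).ne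
  have hLsub : ∀ x y, 0 ≤ x → x ≤ y → y ≤ T →
      L y - L x = (eVariationOn γ (Icc x y)).toReal := fun x y hx hxy hy => by
    have := eVariationOn.Icc_add_Icc γ (s := univ) hx hxy (mem_univ x)
    simp only [univ_inter] at this
    simp only [hLdef, pathLength]
    rw [← this, ENNReal.toReal_add (hfin _ _ le_rfl hx (hxy.trans hy)) (hfin _ _ hx hxy hy)]
    ring
  have hup : ∀ x y, 0 ≤ x → x ≤ y → y ≤ T → L y - L x ≤ Φ y - Φ x := fun x y hx hxy hy => by
    rw [hLsub x y hx hxy hy]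
    exact ENNReal.toReal_le_of_le_ofReal ((norm_nonneg _).trans (hnorm x y hx hxy hy))
      (hvar x y hx hxy hy)
  have hlow : ∀ x y, 0 ≤ x → x ≤ y → y ≤ T → ‖γ y - γ x‖ ≤ L y - L x := fun x y hx hxy hy => by
    rw [hLsub x y hx hxy hy, ← dist_eq_norm, ← ENNReal.ofReal_le_iff_le_toReal (hfin x y hx hxy hy),
      ← edist_dist]
    exact eVariationOn.edist_le γ (right_mem_Icc.2 hxy) (left_mem_Icc.2 hxy)
  have hae := (intervalIntegrable_norm_deriv hL 0 T).ae_hasDerivAt_integral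
  filter_upwards [hd, hae] with s hds has hs
  have hΦs : HasDerivAt Φ ‖deriv γ s‖ s :=
    has (by rw [uIcc_of_le hT.le]; exact Ioo_subset_Icc_self hs) 0 left_mem_uIcc
  have hγs := (hds hs).hasDerivAt
  refine HasDerivAt.deriv (f := L) ?_
  rw [hasDerivAt_iff_tendsto_slope] at hΦs hγs ⊢
  refine tendsto_of_tendsto_of_tendsto_of_le_of_le' hγs.norm hΦs ?_ ?_
  · filter_upwards [mem_nhdsWithin_of_mem_nhds (Ioo_mem_nhds hs.1 hs.2), self_mem_nhdsWithin]
      with r hr hne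
    rcases lt_or_gt_of_ne hne with h | h
    · rw [slope_comm L, slope_comm γ, slope_def_field, slope_def_module, norm_smul, norm_inv,
        Real.norm_of_nonneg (sub_pos.2 h).le, inv_mul_eq_div]
      exact div_le_div_of_nonneg_right (hlow r s hr.1.le h.le hs.2.le) (sub_pos.2 h).le
    · rw [slope_def_field, slope_def_module, norm_smul, norm_inv,
        Real.norm_of_nonneg (sub_pos.2 h).le, inv_mul_eq_div]
      exact div_le_div_of_nonneg_right (hlow s r hs.1.le h.le hr.2.le) (sub_pos.2 h).le
  · filter_upwards [mem_nhdsWithin_of_mem_nhds (Ioo_mem_nhds hs.1 hs.2), self_mem_nhdsWithin]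
      with r hr hne
    rcases lt_or_gt_of_ne hne with h | h
    · rw [slope_comm L, slope_comm Φ, slope_def_field, slope_def_field]
      exact div_le_div_of_nonneg_right (hup r s hr.1.le h.le hs.2.le) (sub_pos.2 h).le
    · rw [slope_def_field, slope_def_field]
      exact div_le_div_of_nonneg_right (hup s r hs.1.le h.le hr.2.le) (sub_pos.2 h).le

end Variation

/-! ### Almost everywhere differentiability of unit-speed paths -/

section Differentiability

variable {X : Type*} [NormedAddCommGroup X] [NormedSpace ℝ X]

/-- A `1`-Lipschitz path into a uniformly convex Banach space is differentiable where its
compositions with functionals of norm at most one have derivatives arbitrarily close to one. -/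
theorem differentiableAt_of_forall_exists_functional [CompleteSpace X] [UniformConvexSpace X]
    {γ : ℝ → X} (hL : LipschitzWith 1 γ) {s : ℝ}
    (h : ∀ η : ℝ, 0 < η → ∃ f : StrongDual ℝ X, ‖f‖ ≤ 1 ∧
      ∃ c : ℝ, 1 - η < c ∧ HasDerivAt (fun t => f (γ t)) c s) :
    DifferentiableAt ℝ γ s ∧ ‖deriv γ s‖ = 1 := by
  have hle : ∀ t, ‖slope γ s t‖ ≤ 1 := fun t => by
    rw [slope_def_module, norm_smul, norm_inv, inv_mul_eq_div]
    refine div_le_one_of_le₀ ?_ (norm_nonneg _)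
    simpa [dist_eq_norm] using hL.dist_le_mul t s
  have hcauchy : Cauchy (map (slope γ s) (𝓝[≠] s)) := by
    refine Metric.cauchy_iff.2 ⟨inferInstance, fun ε hε => ?_⟩
    obtain ⟨δ, hδ, huc⟩ := exists_forall_closed_ball_dist_add_le_two_sub X hε
    -- Near `s` the slopes lie in the slice of the unit ball where `f > 1 - δ / 2`. Two slopes at
    -- distance at least `ε` would have a sum of norm at most `2 - δ`, while `f` exceeds `2 - δ` on
    -- it.
    obtain ⟨f, hf, c, hc, hfc⟩ := h (δ / 2) (by positivity)
    have hev := (hasDerivAt_iff_tendsto_slope.1 hfc).eventually (lt_mem_nhds hc)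
    refine ⟨slope γ s '' {t | 1 - δ / 2 < slope (fun t => f (γ t)) s t}, image_mem_map hev, ?_⟩
    rintro _ ⟨t, ht, rfl⟩ _ ⟨u, hu, rfl⟩
    by_contra! hcon
    rw [dist_eq_norm] at hcon
    have h1 := huc (hle t) (hle u) hcon
    have hslope : ∀ t, slope (fun t => f (γ t)) s t = f (slope γ s t) := fun t => by
      simp [slope_def_module]
    simp only [mem_ofPred_eq, hslope] at ht hu
    have h2 : f (slope γ s t + slope γ s u) ≤ ‖slope γ s t + slope γ s u‖ :=
      (Real.le_norm_self _).trans (f.le_of_opNorm_le hf _ |>.trans (by simp))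
    rw [map_add] at h2
    linarith
  obtain ⟨v, hv⟩ := cauchy_map_iff_exists_tendsto.1 hcauchy
  have hvd : HasDerivAt γ v s := hasDerivAt_iff_tendsto_slope.2 hv
  refine ⟨hvd.differentiableAt, ?_⟩
  rw [hvd.deriv]
  refine le_antisymm (le_of_tendsto hv.norm (Eventually.of_forall hle)) ?_
  refine le_of_forall_pos_le_add fun η hη => ?_
  obtain ⟨f, hf, c, hc, hfc⟩ := h η hη
  have h1 : c = f v := hfc.unique ((f.hasFDerivAt (x := γ s)).comp_hasDerivAt s hvd)
  have h2 : f v ≤ ‖v‖ := (Real.le_norm_self _).trans (f.le_of_opNorm_le hf _ |>.trans (by simp))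
  linarith

/-- Rational pairs keep the family countable, so suprema over it are measurable and exceptional null
sets can be united. -/
theorem exists_norming_functionals {γ : ℝ → X} :
    ∃ f : ℚ × ℚ → StrongDual ℝ X, (∀ n, ‖f n‖ ≤ 1) ∧
      ∀ p q : ℚ, f (p, q) (γ q - γ p) = ‖γ q - γ p‖ := by
  choose f hf using fun n : ℚ × ℚ => exists_dual_vector'' ℝ (γ n.2 - γ n.1)
  exact ⟨f, fun n => (hf n).1, fun p q => (hf (p, q)).2⟩

/-- A path of unit speed in a uniformly convex Banach space is differentiable almost everywhere. -/
theorem ae_differentiableAt_of_le_eVariationOn [CompleteSpace X] [UniformConvexSpace X]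
    {γ : ℝ → X} (hL : LipschitzWith 1 γ) {a b : ℝ} (hab : a ≤ b)
    (hlen : ENNReal.ofReal (b - a) ≤ eVariationOn γ (Icc a b)) :
    ∀ᵐ s, s ∈ Ioo a b → DifferentiableAt ℝ γ s ∧ ‖deriv γ s‖ = 1 := by
  obtain ⟨f, hf, hfγ⟩ := exists_norming_functionals (γ := γ)
  have hLf (n) : LipschitzWith 1 (fun t => f n (γ t)) := by
    have := (f n).lipschitz.comp hL
    exact this.weaken (by simpa [← NNReal.coe_le_coe] using hf n)
  have hle (n s) : |deriv (fun t => f n (γ t)) s| ≤ 1 := by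
    simpa using norm_deriv_le_of_lipschitz (x₀ := s) (hLf n)
  -- `S` plays the role of the speed before differentiability is known: its integral dominates the
  -- length, and `S ≤ 1`, so full length forces `S = 1` almost everywhere.
  set S : ℝ → ℝ := fun s => ⨆ n, |deriv (fun t => f n (γ t)) s| with hS
  have hbdd (s) : BddAbove (range fun n => |deriv (fun t => f n (γ t)) s|) :=
    ⟨1, by rintro _ ⟨n, rfl⟩; exact hle n s⟩
  have hSle (s) : S s ≤ 1 := ciSup_le fun n => hle n s
  have hS0 (s) : 0 ≤ S s := (abs_nonneg _).trans (le_ciSup (hbdd s) (0, 0))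
  have hSm : Measurable S := Measurable.iSup fun n => (measurable_deriv (fun t => f n (γ t))).norm
  have hSi (x y : ℝ) : IntervalIntegrable S volume x y :=
    (intervalIntegrable_const (c := (1 : ℝ))).mono_fun hSm.aestronglyMeasurable
      (Eventually.of_forall fun s => by simpa [abs_of_nonneg (hS0 s)] using hSle s)
  set Φ : ℝ → ℝ := fun r => ∫ s in (0 : ℝ)..r, S s with hΦ
  have hsub (x y : ℝ) : Φ y - Φ x = ∫ s in x..y, S s :=
    intervalIntegral.integral_interval_sub_left (hSi _ _) (hSi _ _)
  have hΦmono : Monotone Φ := fun x y hxy => by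
    have := intervalIntegral.integral_nonneg hxy (f := S) (μ := volume) fun s _ => hS0 s
    rw [← hsub] at this
    linarith
  have hΦc : Continuous Φ := intervalIntegral.continuous_primitive hSi 0
  -- The absolute value makes the bound independent of the order of the points, hence a closed
  -- condition on the whole plane that passes from rational to real pairs.
  have hrat : ∀ p q : ℚ, ‖γ q - γ p‖ ≤ |Φ q - Φ p| := by
    intro p q
    wlog hpq : p ≤ q generalizing p q
    · rw [norm_sub_rev, abs_sub_comm]
      exact this q p (le_of_not_ge hpq)
    have hpq' : (p : ℝ) ≤ q := by exact_mod_cast hpq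
    have hac := ((hLf (p, q)).lipschitzOnWith (s := uIcc (p : ℝ) q)).absolutelyContinuousOnInterval
    rw [hsub, ← hfγ p q, map_sub, ← hac.integral_deriv_eq_sub]
    refine le_trans ?_ (le_abs_self _)
    exact intervalIntegral.integral_mono_on hpq' hac.intervalIntegrable_deriv (hSi _ _)
      fun s _ => (le_abs_self _).trans (le_ciSup (hbdd s) (p, q))
  have hall : ∀ x y : ℝ, ‖γ y - γ x‖ ≤ |Φ y - Φ x| := by
    intro x y
    refine Rat.isDenseEmbedding_coe_real.dense.induction_on₂
      (p := fun x y : ℝ => ‖γ y - γ x‖ ≤ |Φ y - Φ x|) ?_ hrat x y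
    have := hL.continuous
    exact isClosed_le (by fun_prop) (by fun_prop)
  have hvar : eVariationOn γ (Icc a b) ≤ ENNReal.ofReal (Φ b - Φ a) :=
    eVariationOn_Icc_le_of_norm_sub_le hab fun x y _ hxy _ =>
      (hall x y).trans (abs_of_nonneg (sub_nonneg.2 (hΦmono hxy))).le
  have hint : b - a ≤ ∫ s in a..b, S s := by
    rw [← hsub]
    exact (ENNReal.ofReal_le_ofReal_iff (sub_nonneg.2 (hΦmono hab))).1 (hlen.trans hvar)
  have hSone : ∀ᵐ s, s ∈ Ioo a b → S s = 1 := by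
    have hzero : ∫ s in a..b, (1 - S s) = 0 := by
      refine le_antisymm ?_ (intervalIntegral.integral_nonneg hab fun s _ => sub_nonneg.2 (hSle s))
      rw [intervalIntegral.integral_sub intervalIntegrable_const (hSi _ _)]
      simpa using hint
    rw [intervalIntegral.integral_eq_zero_iff_of_le_of_nonneg_ae hab
      (Eventually.of_forall fun s => sub_nonneg.2 (hSle s))
      (intervalIntegrable_const.sub (hSi _ _))] at hzero
    filter_upwards [(ae_restrict_iff' measurableSet_Ioc).1 hzero] with s hs hsm
    have : 1 - S s = 0 := hs (Ioo_subset_Ioc_self hsm)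
    linarith
  have hdiff : ∀ᵐ s, ∀ n, DifferentiableAt ℝ (fun t => f n (γ t)) s :=
    ae_all_iff.2 fun n => (hLf n).ae_differentiableAt_real
  filter_upwards [hSone, hdiff] with s hs hd hsm
  refine differentiableAt_of_forall_exists_functional hL fun η hη => ?_
  obtain ⟨n, hn⟩ := exists_lt_of_lt_ciSup (show 1 - η < S s by rw [hs hsm]; linarith)
  rcases le_total 0 (deriv (fun t => f n (γ t)) s) with h0 | h0
  · rw [abs_of_nonneg h0] at hn
    exact ⟨f n, hf n, _, hn, (hd n).hasDerivAt⟩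
  · rw [abs_of_nonpos h0] at hn
    exact ⟨-f n, by simpa using hf n, _, hn, (hd n).hasDerivAt.neg⟩

end Differentiability

/-! ### Pointwise estimates from the two moduli -/

section Moduli

variable {X : Type*} [NormedAddCommGroup X] [NormedSpace ℝ X]

theorem modulusOfConvexity_nonneg (ε : ℝ) : 0 ≤ modulusOfConvexity X ε := by
  refine Real.sInf_nonneg ?_
  rintro r ⟨x, y, hx, hy, -, rfl⟩
  have := norm_add_le x y
  linarith

theorem modulusOfConvexity_norm_sub_le {x y : X} (hx : ‖x‖ = 1) (hy : ‖y‖ = 1) :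
    modulusOfConvexity X ‖x - y‖ ≤ 1 - ‖x + y‖ / 2 := by
  refine csInf_le ⟨0, ?_⟩ ⟨x, y, hx, hy, rfl, rfl⟩
  rintro r ⟨u, v, hu, hv, -, rfl⟩
  have := norm_add_le u v
  linarith

theorem norm_add_add_norm_sub_le_modulusOfSmoothness {x y : X} (hx : ‖x‖ = 1) :
    (‖x + y‖ + ‖x - y‖) / 2 - 1 ≤ modulusOfSmoothness X ‖y‖ := by
  refine le_csSup ⟨‖y‖, ?_⟩ ⟨x, y, hx, rfl, rfl⟩
  rintro r ⟨u, v, hu, hv, rfl⟩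
  have := norm_add_le u v
  have := norm_sub_le u v
  linarith

theorem mul_sq_norm_sub_le_modulusOfConvexity {M : ℝ}
    (hM : ∀ ε : ℝ, 0 < ε → ε ≤ 2 → M * ε ^ (2 : ℝ) ≤ modulusOfConvexity X ε) {x y : X}
    (hx : ‖x‖ = 1) (hy : ‖y‖ = 1) : M * ‖x - y‖ ^ 2 ≤ modulusOfConvexity X ‖x - y‖ := by
  rcases (norm_nonneg (x - y)).eq_or_lt with h | h
  · rw [← h]
    simpa using modulusOfConvexity_nonneg (X := X) 0
  · have := norm_sub_le x y
    simpa using hM _ h (by linarith)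

theorem UniformlyConvexOfPowerType.uniformConvexSpace
    (h : UniformlyConvexOfPowerType X 2) : UniformConvexSpace X := by
  obtain ⟨M, hM, hδ⟩ := h
  refine ⟨fun ε hε => ⟨2 * (M * ε ^ 2), by positivity, fun x hx y hy hxy => ?_⟩⟩
  have h1 := mul_sq_norm_sub_le_modulusOfConvexity hδ hx hy
  have h2 := modulusOfConvexity_norm_sub_le hx hy
  have h3 : M * ε ^ 2 ≤ M * ‖x - y‖ ^ 2 := by gcongr
  linarith

theorem norm_add_add_norm_sub_le_of_modulusOfSmoothness_le {K : ℝ}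
    (hK : ∀ τ : ℝ, 0 < τ → modulusOfSmoothness X τ ≤ K * τ ^ (2 : ℝ)) {w : X} (hw : 0 < ‖w‖)
    (z : X) : (‖w + z‖ + ‖w - z‖) / 2 ≤ ‖w‖ + K * ‖z‖ ^ 2 / ‖w‖ := by
  rcases eq_or_ne z 0 with rfl | hz
  · simp
  have hz' : 0 < ‖z‖ := norm_pos_iff.2 hz
  have hw1 : ‖‖w‖⁻¹ • w‖ = 1 := by
    rw [norm_smul, norm_inv, norm_norm, inv_mul_cancel₀ hw.ne']
  have hz1 : ‖‖w‖⁻¹ • z‖ = ‖w‖⁻¹ * ‖z‖ := by rw [norm_smul, norm_inv, norm_norm]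
  have h1 := norm_add_add_norm_sub_le_modulusOfSmoothness (y := ‖w‖⁻¹ • z) hw1
  have h2 := h1.trans (hK _ (by rw [hz1]; positivity))
  rw [← smul_add, ← smul_sub, norm_smul, norm_smul, hz1, norm_inv, norm_norm, Real.rpow_two] at h2
  have h3 := mul_le_mul_of_nonneg_left h2 hw.le
  have e1 : ‖w‖ * ((‖w‖⁻¹ * ‖w + z‖ + ‖w‖⁻¹ * ‖w - z‖) / 2 - 1)
      = (‖w + z‖ + ‖w - z‖) / 2 - ‖w‖ := by field_simp
  have e2 : ‖w‖ * (K * (‖w‖⁻¹ * ‖z‖) ^ 2) = K * ‖z‖ ^ 2 / ‖w‖ := by field_simp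
  rw [e1, e2] at h3
  linarith

/-- The smoothness inequality is applied at the midpoint with half the difference as perturbation.
It bounds how far the norm of the midpoint falls below the mean of the norms. -/
theorem inv_norm_midpoint_le {K : ℝ} (hK0 : 0 < K)
    (hK : ∀ τ : ℝ, 0 < τ → modulusOfSmoothness X τ ≤ K * τ ^ (2 : ℝ)) {a b : X}
    (ha : 1 ≤ ‖a‖) (hb : 1 ≤ ‖b‖) (hm : 1 ≤ ‖(1 / 2 : ℝ) • (a + b)‖) :
    ‖(1 / 2 : ℝ) • (a + b)‖⁻¹ ≤ 2 / (‖a‖ + ‖b‖) + K / 4 * ‖a - b‖ ^ 2 := by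
  have h := norm_add_add_norm_sub_le_of_modulusOfSmoothness_le hK (zero_lt_one.trans_le hm)
    ((1 / 2 : ℝ) • (a - b))
  have e1 : (1 / 2 : ℝ) • (a + b) + (1 / 2 : ℝ) • (a - b) = a := by module
  have e2 : (1 / 2 : ℝ) • (a + b) - (1 / 2 : ℝ) • (a - b) = b := by module
  rw [e1, e2, norm_smul (1 / 2 : ℝ) (a - b), Real.norm_of_nonneg (by norm_num)] at h
  set r := ‖(1 / 2 : ℝ) • (a + b)‖
  set g := ‖a - b‖
  have hr : 0 < r := zero_lt_one.trans_le hm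
  have hs : 2 ≤ ‖a‖ + ‖b‖ := by linarith
  have h1 : K * (1 / 2 * g) ^ 2 / r ≤ K * (1 / 2 * g) ^ 2 := div_le_self (by positivity) hm
  have hrs : 2 ≤ r * (‖a‖ + ‖b‖) := by nlinarith
  have h2 : r⁻¹ - 2 / (‖a‖ + ‖b‖) = (‖a‖ + ‖b‖ - 2 * r) / (r * (‖a‖ + ‖b‖)) := by field_simp
  -- The numerator is at most `2 * K * (g / 2) ^ 2 = K / 2 * g ^ 2` and the denominator is at least
  -- `2`.
  have h3 : (‖a‖ + ‖b‖ - 2 * r) / (r * (‖a‖ + ‖b‖)) ≤ K / 4 * g ^ 2 := by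
    rw [div_le_iff₀ (by linarith)]
    have : 0 ≤ K / 4 * g ^ 2 := by positivity
    nlinarith
  linarith

/-- The pointwise comparison of the quasihyperbolic length elements: `u` and `v` are the
derivatives of the two paths, `a` and `b` their positions. -/
theorem norm_midpoint_div_add_modulus_le {K M : ℝ} (hK0 : 0 < K) (hM0 : 0 < M)
    (hK : ∀ τ : ℝ, 0 < τ → modulusOfSmoothness X τ ≤ K * τ ^ (2 : ℝ))
    (hM : ∀ ε : ℝ, 0 < ε → ε ≤ 2 → M * ε ^ (2 : ℝ) ≤ modulusOfConvexity X ε)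
    {a b u v : X} (ha : 1 ≤ ‖a‖) (hb : 1 ≤ ‖b‖) (hm : 1 ≤ ‖(1 / 2 : ℝ) • (a + b)‖)
    (ha2 : ‖a‖ ≤ 2) (hb2 : ‖b‖ ≤ 2) (hu : ‖u‖ = 1) (hv : ‖v‖ = 1) :
    ‖(1 / 2 : ℝ) • (u + v)‖ / ‖(1 / 2 : ℝ) • (a + b)‖
        + (modulusOfConvexity X ‖u - v‖ / (‖a‖ + ‖b‖) + M / 4 * ‖u - v‖ ^ 2) ≤
      (1 / ‖a‖ + 1 / ‖b‖) / 2 + K / 4 * ‖a - b‖ ^ 2 := by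
  have h1 := inv_norm_midpoint_le hK0 hK ha hb hm
  have h2 := modulusOfConvexity_norm_sub_le hu hv
  have h3 := mul_sq_norm_sub_le_modulusOfConvexity hM hu hv
  have h4 : ‖(1 / 2 : ℝ) • (u + v)‖ = ‖u + v‖ / 2 := by
    rw [norm_smul]; norm_num; ring
  have h5 : 2 * ‖(1 / 2 : ℝ) • (a + b)‖ ≤ ‖a‖ + ‖b‖ := by
    rw [norm_smul, Real.norm_of_nonneg (by norm_num)]
    linarith [norm_add_le a b]
  rw [h4]
  set d := modulusOfConvexity X ‖u - v‖
  set r := ‖(1 / 2 : ℝ) • (a + b)‖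
  set p := ‖a‖
  set q := ‖b‖
  set e := ‖u - v‖
  have hd : 0 ≤ d := modulusOfConvexity_nonneg _
  have hr : 0 < r := by linarith
  have hp : 0 < p := by linarith
  have hq : 0 < q := by linarith
  have g1 : ‖u + v‖ / 2 / r ≤ r⁻¹ - d / r := by
    rw [← one_div, ← sub_div]
    exact div_le_div_of_nonneg_right (by linarith) hr.le
  -- As `2 * r ≤ p + q`, the gain splits into two copies: one is kept, and `g3` converts the other
  -- using `p + q ≤ 4`.
  have g2 : 2 * (d / (p + q)) ≤ d / r := by
    rw [← mul_div_assoc, div_le_div_iff₀ (by positivity) hr]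
    nlinarith
  have g3 : M / 4 * e ^ 2 ≤ d / (p + q) := by
    rw [le_div_iff₀ (by positivity)]
    have : 0 ≤ M / 4 * e ^ 2 := by positivity
    nlinarith
  have g4 : 2 / (p + q) ≤ (1 / p + 1 / q) / 2 := by
    rw [div_add_div _ _ hp.ne' hq.ne', div_div, div_le_div_iff₀ (by positivity) (by positivity)]
    nlinarith [sq_nonneg (p - q)]
  linarith

/-- Nontriviality makes the origin non-isolated, so that it is the whole frontier. -/
theorem boundaryDist_compl_zero [Nontrivial X] (x : X) : boundaryDist ({(0 : X)}ᶜ) x = ‖x‖ := by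
  have : NeBot (𝓝[≠] (0 : X)) := Module.punctured_nhds_neBot ℝ X 0
  rw [boundaryDist, frontier_compl, frontier, closure_singleton, interior_singleton, sdiff_empty,
    Metric.infDist_singleton, dist_zero_right]

end Moduli

/-! ### Cauchy–Schwarz and global Lipschitz extensions -/

section Paths

theorem setLIntegral_Icc_add_Icc (F : ℝ → ℝ≥0∞) {a b c : ℝ} (hab : a ≤ b) (hbc : b ≤ c) :
    ∫⁻ s in Icc a c, F s = (∫⁻ s in Icc a b, F s) + ∫⁻ s in Icc b c, F s := by
  rw [← setLIntegral_congr (Ioc_ae_eq_Icc (a := a) (b := b)),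
    ← setLIntegral_congr (Ioc_ae_eq_Icc (a := b) (b := c)),
    ← setLIntegral_congr (Ioc_ae_eq_Icc (a := a) (b := c)), ← Ioc_union_Ioc_eq_Ioc hab hbc,
    lintegral_union measurableSet_Ioc (Ioc_disjoint_Ioc_of_le le_rfl)]

theorem sq_integral_le_mul_integral_sq {e : ℝ → ℝ} {t : ℝ} (ht : 0 ≤ t)
    (he : IntervalIntegrable e volume 0 t)
    (he2 : IntervalIntegrable (fun s => e s ^ 2) volume 0 t) :
    (∫ s in (0 : ℝ)..t, e s) ^ 2 ≤ t * ∫ s in (0 : ℝ)..t, e s ^ 2 := by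
  rcases ht.eq_or_lt with rfl | ht'
  · simp
  -- With `c` the mean of `e`, the inequality is the nonnegativity of the integral of `(e - c) ^ 2`.
  set c := (∫ s in (0 : ℝ)..t, e s) / t with hc
  have h0 : 0 ≤ ∫ s in (0 : ℝ)..t, (e s ^ 2 - 2 * c * e s + c ^ 2) :=
    intervalIntegral.integral_nonneg ht fun s _ => by nlinarith [sq_nonneg (e s - c)]
  rw [intervalIntegral.integral_add (he2.sub (he.const_mul _)) intervalIntegrable_const,
    intervalIntegral.integral_sub he2 (he.const_mul _), intervalIntegral.integral_const_mul,
    intervalIntegral.integral_const, smul_eq_mul, sub_zero] at h0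
  have hct : ∫ s in (0 : ℝ)..t, e s = c * t := by rw [hc]; field_simp
  rw [hct] at h0 ⊢
  have := mul_nonneg ht h0
  nlinarith

variable {X : Type*} [NormedAddCommGroup X]

theorem lipschitzOnWith_of_hasUnitSpeedOn {γ : ℝ → X} {t : ℝ} (h : HasUnitSpeedOn γ (Icc 0 t)) :
    LipschitzOnWith 1 γ (Icc 0 t) := by
  have key : ∀ x ∈ Icc 0 t, ∀ y ∈ Icc 0 t, x ≤ y → edist (γ x) (γ y) ≤ edist x y := by
    intro x hx y hy hxy
    have h1 := h hx hy
    rw [edist_comm x y, edist_dist y x, Real.dist_eq, abs_of_nonneg (sub_nonneg.2 hxy)]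
    refine (eVariationOn.edist_le γ (s := Icc 0 t ∩ Icc x y) ⟨hx, left_mem_Icc.2 hxy⟩
      ⟨hy, right_mem_Icc.2 hxy⟩).trans ?_
    rw [h1]; simp
  intro x hx y hy
  rw [ENNReal.coe_one, one_mul]
  rcases le_total x y with hxy | hxy
  · exact key x hx y hy hxy
  · rw [edist_comm (γ x), edist_comm x]
    exact key y hy x hx hxy

/-- A path of unit speed that stays constant from the time `t` on agrees with a `1`-Lipschitz
path on the whole line. -/
theorem exists_lipschitzWith_eqOn {γ : ℝ → X} {t T : ℝ} (ht : 0 ≤ t)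
    (h : HasUnitSpeedOn γ (Icc 0 t)) (hconst : ∀ s ∈ Icc t T, γ s = γ t) :
    ∃ Γ : ℝ → X, LipschitzWith 1 Γ ∧ EqOn γ Γ (Icc 0 T) ∧ ∀ s, t ≤ s → Γ s = Γ t := by
  have hL := lipschitzOnWith_of_hasUnitSpeedOn h
  have hE : LipschitzWith 1 (IccExtend ht ((Icc 0 t).domRestrict γ)) := by
    have := (lipschitzOnWith_iff_restrict.1 hL).comp (LipschitzWith.projIcc ht)
    rwa [mul_one] at this
  refine ⟨_, hE, fun s hs => ?_, fun s hs => ?_⟩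
  · rcases le_total s t with hst | hst
    · rw [IccExtend_of_mem ht _ ⟨hs.1, hst⟩]; rfl
    · rw [IccExtend_of_right_le ht _ hst, hconst s ⟨hst, hs.2⟩]; rfl
  · rw [IccExtend_of_right_le ht _ hs, IccExtend_of_right_le ht _ le_rfl]

end Paths

/-! ### Integrated comparison for the midpoint path -/

section Midpoint

theorem ofReal_div_ofReal_norm {c : ℝ} {X : Type*} [NormedAddCommGroup X] {x : X} (hx : 1 ≤ ‖x‖) :
    ENNReal.ofReal c / ENNReal.ofReal ‖x‖ = ENNReal.ofReal (c / ‖x‖) :=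
  (ENNReal.ofReal_div_of_pos (zero_lt_one.trans_le hx)).symm

variable {X : Type*} [NormedAddCommGroup X] [NormedSpace ℝ X]

theorem lipschitzWith_midpoint {γ₁ γ₂ : ℝ → X} (h₁ : LipschitzWith 1 γ₁)
    (h₂ : LipschitzWith 1 γ₂) :
    LipschitzWith (‖(1 / 2 : ℝ)‖₊ * (1 + 1)) (fun t => (1 / 2 : ℝ) • (γ₁ t + γ₂ t)) :=
  (lipschitzWith_smul (1 / 2 : ℝ)).comp (h₁.add h₂)

theorem ae_Icc_of_ae_Ioo {p : ℝ → Prop} {a b : ℝ} (h : ∀ᵐ s, s ∈ Ioo a b → p s) :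
    ∀ᵐ s ∂volume.restrict (Icc a b), p s := by
  rw [← restrict_Ioo_eq_restrict_Icc]
  exact (ae_restrict_iff' measurableSet_Ioo).2 h

/-- The Poincaré type inequality for the difference of two paths that start at the same point. -/
theorem lintegral_sq_norm_sub_le [CompleteSpace X] {γ₁ γ₂ : ℝ → X} (h₁ : LipschitzWith 1 γ₁)
    (h₂ : LipschitzWith 1 γ₂) {t K M : ℝ} (ht : 0 ≤ t) (hK : 0 ≤ K) (hM : 0 ≤ M)
    (hKM : K * t ^ 2 ≤ M) (h0 : γ₁ 0 = γ₂ 0)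
    (hd₁ : ∀ᵐ s, s ∈ Ioo 0 t → DifferentiableAt ℝ γ₁ s)
    (hd₂ : ∀ᵐ s, s ∈ Ioo 0 t → DifferentiableAt ℝ γ₂ s) :
    ∫⁻ s in Icc 0 t, ENNReal.ofReal (K * ‖γ₁ s - γ₂ s‖ ^ 2) ≤
        ∫⁻ s in Icc 0 t, ENNReal.ofReal (M * ‖deriv (fun r => γ₁ r - γ₂ r) s‖ ^ 2) ∧
      ∫⁻ s in Icc 0 t, ENNReal.ofReal (M * ‖deriv (fun r => γ₁ r - γ₂ r) s‖ ^ 2) ≠ ∞ := by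
  set D : ℝ → X := fun r => γ₁ r - γ₂ r with hD
  set e : ℝ → ℝ := fun s => ‖deriv D s‖ with he
  have hDL : LipschitzWith (1 + 1) D := h₁.sub h₂
  have hei (a b : ℝ) : IntervalIntegrable e volume a b := intervalIntegrable_norm_deriv hDL a b
  have he2 (s : ℝ) : e s ≤ 2 := by
    have := norm_deriv_le_of_lipschitz (x₀ := s) hDL
    norm_num at this
    exact this
  have hem : Measurable e := by
    borelize X
    exact (measurable_deriv D).norm
  have he0 (s : ℝ) : 0 ≤ e s := norm_nonneg _
  have he2i (a b : ℝ) : IntervalIntegrable (fun s => e s ^ 2) volume a b :=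
    (intervalIntegrable_const (c := (4 : ℝ))).mono_fun (hem.pow_const 2).aestronglyMeasurable
      (Eventually.of_forall fun s => by
        simp only [Real.norm_eq_abs, abs_of_nonneg (sq_nonneg (e s))]
        norm_num
        nlinarith [he2 s, he0 s])
  have hDd : ∀ᵐ s, s ∈ Ioo 0 t → DifferentiableAt ℝ D s := by
    filter_upwards [hd₁, hd₂] with s hs₁ hs₂ hs using (hs₁ hs).sub (hs₂ hs)
  set E2 := ∫ s in (0 : ℝ)..t, e s ^ 2 with hE2
  have hE20 : 0 ≤ E2 := intervalIntegral.integral_nonneg ht fun s _ => sq_nonneg _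
  -- The common starting point gives `D 0 = 0`, so `‖D s‖` is bounded by the integral of its speed.
  have hbound : ∀ s ∈ Icc 0 t, ‖D s‖ ^ 2 ≤ t * E2 := by
    intro s hs
    have hDs : ‖D s‖ ≤ ∫ r in (0 : ℝ)..s, e r := by
      have := norm_sub_le_integral_norm_deriv hDL hs.1 (by
        filter_upwards [hDd] with r hr hrs using hr ⟨hrs.1, hrs.2.trans_le hs.2⟩)
      rwa [show D 0 = 0 from sub_eq_zero.2 h0, sub_zero] at this
    have hst : ∫ r in (0 : ℝ)..s, e r ≤ ∫ r in (0 : ℝ)..t, e r :=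
      intervalIntegral.integral_mono_interval le_rfl hs.1 hs.2 (Eventually.of_forall he0) (hei 0 t)
    calc ‖D s‖ ^ 2 ≤ (∫ r in (0 : ℝ)..t, e r) ^ 2 := by
          gcongr
          exact hDs.trans hst
      _ ≤ t * E2 := sq_integral_le_mul_integral_sq ht (hei 0 t) (he2i 0 t)
  have hR : ∫⁻ s in Icc 0 t, ENNReal.ofReal (M * e s ^ 2) = ENNReal.ofReal (M * E2) := by
    have hint : IntegrableOn (fun s => M * e s ^ 2) (Icc 0 t) := by
      rw [integrableOn_Icc_iff_integrableOn_Ioc]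
      exact (intervalIntegrable_iff_integrableOn_Ioc_of_le ht).1 ((he2i 0 t).const_mul M)
    rw [← ofReal_integral_eq_lintegral_ofReal hint
      (Eventually.of_forall fun s => mul_nonneg hM (sq_nonneg _)), integral_const_mul,
      integral_Icc_eq_integral_Ioc, ← intervalIntegral.integral_of_le ht]
  refine ⟨?_, hR ▸ ENNReal.ofReal_ne_top⟩
  calc ∫⁻ s in Icc 0 t, ENNReal.ofReal (K * ‖D s‖ ^ 2)
      ≤ ∫⁻ _ in Icc 0 t, ENNReal.ofReal (K * (t * E2)) :=
        setLIntegral_mono measurable_const fun s hs =>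
          ENNReal.ofReal_le_ofReal (mul_le_mul_of_nonneg_left (hbound s hs) hK)
    _ = ENNReal.ofReal (K * t ^ 2 * E2) := by
        rw [setLIntegral_const, Real.volume_Icc, sub_zero, ← ENNReal.ofReal_mul (by positivity)]
        congr 1; ring
    _ ≤ ENNReal.ofReal (M * E2) := ENNReal.ofReal_le_ofReal (by gcongr)
    _ = _ := hR.symm

/-- Along the common part of the parameter intervals the midpoint path gains the modulus of
convexity. -/
theorem lintegral_midpoint_add_modulus_le [CompleteSpace X] {K M : ℝ} (hK0 : 0 < K) (hM0 : 0 < M)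
    (hK : ∀ τ : ℝ, 0 < τ → modulusOfSmoothness X τ ≤ K * τ ^ (2 : ℝ))
    (hM : ∀ ε : ℝ, 0 < ε → ε ≤ 2 → M * ε ^ (2 : ℝ) ≤ modulusOfConvexity X ε)
    {γ₁ γ₂ : ℝ → X} (h₁ : LipschitzWith 1 γ₁) (h₂ : LipschitzWith 1 γ₂) {t : ℝ} (ht : 0 ≤ t)
    (hKM : K * t ^ 2 ≤ M) (h0 : γ₁ 0 = γ₂ 0)
    (hd₁ : ∀ᵐ s, s ∈ Ioo 0 t → DifferentiableAt ℝ γ₁ s ∧ ‖deriv γ₁ s‖ = 1)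
    (hd₂ : ∀ᵐ s, s ∈ Ioo 0 t → DifferentiableAt ℝ γ₂ s ∧ ‖deriv γ₂ s‖ = 1)
    (hn₁ : ∀ s ∈ Icc 0 t, 1 ≤ ‖γ₁ s‖ ∧ ‖γ₁ s‖ ≤ 2)
    (hn₂ : ∀ s ∈ Icc 0 t, 1 ≤ ‖γ₂ s‖ ∧ ‖γ₂ s‖ ≤ 2)
    (hm : ∀ s ∈ Icc 0 t, 1 ≤ ‖(1 / 2 : ℝ) • (γ₁ s + γ₂ s)‖) :
    (∫⁻ s in Icc 0 t, ENNReal.ofReal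
        (‖deriv (fun r => (1 / 2 : ℝ) • (γ₁ r + γ₂ r)) s‖ / ‖(1 / 2 : ℝ) • (γ₁ s + γ₂ s)‖)) +
      ∫⁻ s in Icc 0 t, ENNReal.ofReal
        (modulusOfConvexity X ‖deriv (fun r => γ₁ r - γ₂ r) s‖ / (‖γ₁ s‖ + ‖γ₂ s‖)) ≤
    ((∫⁻ s in Icc 0 t, ENNReal.ofReal (1 / ‖γ₁ s‖)) +
      ∫⁻ s in Icc 0 t, ENNReal.ofReal (1 / ‖γ₂ s‖)) / 2 := by
  borelize X
  set m : ℝ → X := fun r => (1 / 2 : ℝ) • (γ₁ r + γ₂ r) with hmdef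
  set D : ℝ → X := fun r => γ₁ r - γ₂ r with hDdef
  have hc₁ := h₁.continuous
  have hc₂ := h₂.continuous
  have hcm : Continuous m := by fun_prop
  obtain ⟨hGE, hE⟩ := lintegral_sq_norm_sub_le h₁ h₂ ht (show 0 ≤ K / 4 by positivity)
    (show 0 ≤ M / 4 by positivity) (by linarith) h0
    (hd₁.mono fun s h hs => (h hs).1) (hd₂.mono fun s h hs => (h hs).1)
  have hmA : Measurable fun s => ENNReal.ofReal (‖deriv m s‖ / ‖m s‖) :=
    ((measurable_deriv m).norm.div hcm.measurable.norm).ennreal_ofReal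
  have hmE : Measurable fun s => ENNReal.ofReal (M / 4 * ‖deriv D s‖ ^ 2) :=
    (((measurable_deriv D).norm.pow_const 2).const_mul _).ennreal_ofReal
  have hmP : Measurable fun s => ENNReal.ofReal (1 / ‖γ₁ s‖) :=
    (hc₁.measurable.norm.const_div 1).ennreal_ofReal
  have hmQ : Measurable fun s => ENNReal.ofReal (1 / ‖γ₂ s‖) :=
    (hc₂.measurable.norm.const_div 1).ennreal_ofReal
  have hmPQ : Measurable fun s => (ENNReal.ofReal (1 / ‖γ₁ s‖) + ENNReal.ofReal (1 / ‖γ₂ s‖)) / 2 :=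
    (hmP.add hmQ).div_const 2
  -- Adding the finite energy to both sides replaces a subtraction in `ℝ≥0∞`.
  refine (ENNReal.add_le_add_iff_right hE).1 ?_
  calc _ = ∫⁻ s in Icc 0 t, (ENNReal.ofReal (‖deriv m s‖ / ‖m s‖) +
          (ENNReal.ofReal (modulusOfConvexity X ‖deriv D s‖ / (‖γ₁ s‖ + ‖γ₂ s‖)) +
            ENNReal.ofReal (M / 4 * ‖deriv D s‖ ^ 2))) := by
        -- Only the outer summands must be measurable, so no measurability of the modulus of
        -- convexity is needed.
        rw [lintegral_add_left hmA, lintegral_add_right _ hmE, add_assoc]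
    _ ≤ ∫⁻ s in Icc 0 t, ((ENNReal.ofReal (1 / ‖γ₁ s‖) + ENNReal.ofReal (1 / ‖γ₂ s‖)) / 2 +
          ENNReal.ofReal (K / 4 * ‖γ₁ s - γ₂ s‖ ^ 2)) := by
        refine lintegral_mono_ae (ae_Icc_of_ae_Ioo ?_)
        filter_upwards [hd₁, hd₂] with s hs₁ hs₂ hs
        have hsI := Ioo_subset_Icc_self hs
        have hg₁ := (hs₁ hs).1.hasDerivAt
        have hg₂ := (hs₂ hs).1.hasDerivAt
        have hdm : deriv m s = (1 / 2 : ℝ) • (deriv γ₁ s + deriv γ₂ s) :=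
          ((hg₁.add hg₂).const_smul (1 / 2 : ℝ)).deriv
        have hdD : deriv D s = deriv γ₁ s - deriv γ₂ s := (hg₁.sub hg₂).deriv
        have key := norm_midpoint_div_add_modulus_le hK0 hM0 hK hM (hn₁ s hsI).1 (hn₂ s hsI).1
          (hm s hsI) (hn₁ s hsI).2 (hn₂ s hsI).2 (hs₁ hs).2 (hs₂ hs).2
        rw [hdm, hdD, ← ENNReal.ofReal_add (div_nonneg (modulusOfConvexity_nonneg _)
          (by positivity)) (by positivity), ← ENNReal.ofReal_add (by positivity)
          (add_nonneg (div_nonneg (modulusOfConvexity_nonneg _) (by positivity)) (by positivity)),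
          ← ENNReal.ofReal_add (by positivity) (by positivity), ← ENNReal.ofReal_ofNat 2,
          ← ENNReal.ofReal_div_of_pos (by norm_num), ← ENNReal.ofReal_add (by positivity)
          (by positivity)]
        exact ENNReal.ofReal_le_ofReal key
    _ = ((∫⁻ s in Icc 0 t, ENNReal.ofReal (1 / ‖γ₁ s‖)) +
          ∫⁻ s in Icc 0 t, ENNReal.ofReal (1 / ‖γ₂ s‖)) / 2 +
          ∫⁻ s in Icc 0 t, ENNReal.ofReal (K / 4 * ‖γ₁ s - γ₂ s‖ ^ 2) := by
        rw [lintegral_add_left hmPQ]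
        simp only [div_eq_mul_inv]
        rw [lintegral_mul_const _ (by
          simpa only [div_eq_mul_inv, Pi.add_def] using hmP.add hmQ),
          lintegral_add_left (by simpa only [div_eq_mul_inv] using hmP)]
    _ ≤ _ := by gcongr

end Midpoint

end QuasihyperbolicPaths

/-! ### The main theorem -/

open QuasihyperbolicPaths in
theorem mainTheorem5 (X : Type*) [NormedAddCommGroup X] [NormedSpace ℝ X] [CompleteSpace X]
    (hdim : 2 ≤ Module.rank ℝ X)
    (hconv : QuasihyperbolicPaths.UniformlyConvexOfPowerType X 2)
    (hsmooth : QuasihyperbolicPaths.UniformlySmoothOfPowerType X 2)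
    (Ω : Set X) (hΩ : Ω = {(0 : X)}ᶜ) :
    ∃ R : ℝ, 0 < R ∧ ∀ (t₁ t₂ : ℝ) (γ₁ γ₂ : ℝ → X),
      0 ≤ t₁ → t₁ ≤ t₂ →
      QuasihyperbolicPaths.IsRectifiablePath Ω t₂ γ₁ →
      QuasihyperbolicPaths.IsRectifiablePath Ω t₂ γ₂ →
      (∀ t ∈ Icc 0 t₂, 1 ≤ ‖γ₁ t‖ ∧ ‖γ₁ t‖ ≤ 2) →
      (∀ t ∈ Icc 0 t₂, 1 ≤ ‖γ₂ t‖ ∧ ‖γ₂ t‖ ≤ 2) →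
      (∀ t ∈ Icc 0 t₂, 1 ≤ ‖(1 / 2 : ℝ) • (γ₁ t + γ₂ t)‖ ∧ ‖(1 / 2 : ℝ) • (γ₁ t + γ₂ t)‖ ≤ 2) →
      γ₁ 0 = γ₂ 0 →
      max (QuasihyperbolicPaths.qhLength Ω γ₁ 0 t₂)
        (QuasihyperbolicPaths.qhLength Ω γ₂ 0 t₂) ≤ ENNReal.ofReal R →
      QuasihyperbolicPaths.pathLength γ₁ 0 t₂ = ENNReal.ofReal t₁ →
      QuasihyperbolicPaths.pathLength γ₂ 0 t₂ = ENNReal.ofReal t₂ →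
      HasUnitSpeedOn γ₁ (Icc 0 t₁) →
      (∀ t ∈ Icc t₁ t₂, γ₁ t = γ₁ t₁) →
      HasUnitSpeedOn γ₂ (Icc 0 t₂) →
      QuasihyperbolicPaths.qhLength Ω (fun t => (1 / 2 : ℝ) • (γ₁ t + γ₂ t)) 0 t₂ +
          ∫⁻ s in Icc 0 t₁, ENNReal.ofReal
            (QuasihyperbolicPaths.modulusOfConvexity X
                (QuasihyperbolicPaths.lengthElement (fun t => γ₁ t - γ₂ t) s) /
              (‖γ₁ s‖ + ‖γ₂ s‖)) ≤
        (QuasihyperbolicPaths.qhLength Ω γ₁ 0 t₂ + QuasihyperbolicPaths.qhLength Ω γ₂ 0 t₂) / 2 +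
          ∫⁻ s in Icc t₁ t₂, ENNReal.ofReal (QuasihyperbolicPaths.lengthElement γ₂ s) /
            (2 * ENNReal.ofReal (QuasihyperbolicPaths.boundaryDist Ω (γ₂ s))) := by
  have : UniformConvexSpace X := hconv.uniformConvexSpace
  have hnt : Nontrivial X := by
    refine (rank_pos_iff_nontrivial (R := ℝ)).1 (lt_of_lt_of_le ?_ hdim)
    exact zero_lt_two
  obtain ⟨M, hM0, hM⟩ := hconv
  obtain ⟨K, hK0, hK⟩ := hsmooth
  subst hΩ
  -- Norms at most `2` give `t₁ / 2 ≤ ℓ_k(γ₁) ≤ R`, so this `R` yields exactly `K * t₁ ^ 2 ≤ M`.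
  refine ⟨√(M / K) / 2, by positivity, ?_⟩
  intro t₁ t₂ γ₁ γ₂ ht₁ ht₁₂ _ _ hn₁ hn₂ hm h0 hR _ _ hu₁ hconst hu₂
  have ht₂ := ht₁.trans ht₁₂
  obtain ⟨Γ₁, hL₁, heq₁, hΓconst⟩ := exists_lipschitzWith_eqOn ht₁ hu₁ hconst
  obtain ⟨Γ₂, hL₂, heq₂, -⟩ := exists_lipschitzWith_eqOn ht₂ hu₂ (T := t₂) (by
    rintro s ⟨h1, h2⟩; rw [le_antisymm h2 h1])
  have hlen {γ Γ : ℝ → X} {t : ℝ} (ht : 0 ≤ t) (htt : t ≤ t₂) (heq : EqOn γ Γ (Icc 0 t₂))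
      (hu : HasUnitSpeedOn γ (Icc 0 t)) :
      ENNReal.ofReal (t - 0) ≤ eVariationOn Γ (Icc 0 t) := by
    have := hu (left_mem_Icc.2 ht) (right_mem_Icc.2 ht)
    rw [inter_self, NNReal.coe_one, one_mul] at this
    rw [← this, eVariationOn.congr (heq.mono (Icc_subset_Icc_right htt))]
  have hd₁ := ae_differentiableAt_of_le_eVariationOn hL₁ ht₁ (hlen ht₁ ht₁₂ heq₁ hu₁)
  have hd₂ := ae_differentiableAt_of_le_eVariationOn hL₂ ht₂ (hlen ht₂ le_rfl heq₂ hu₂)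
  have hz₁ : ∀ s, t₁ < s → HasDerivAt Γ₁ 0 s := fun s hs =>
    (hasDerivAt_const s (Γ₁ t₁)).congr_of_eventuallyEq (by
      filter_upwards [Ioi_mem_nhds hs] with r hr using hΓconst r (le_of_lt hr))
  have hD₁ : ∀ᵐ s, s ∈ Ioo 0 t₂ → DifferentiableAt ℝ Γ₁ s := by
    filter_upwards [hd₁, compl_mem_ae_iff.2 (measure_singleton t₁)] with s hs hne hst
    rcases lt_or_gt_of_ne hne with h | h
    · exact (hs ⟨hst.1, h⟩).1
    · exact (hz₁ s h).differentiableAt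
  have hD₂ : ∀ᵐ s, s ∈ Ioo 0 t₂ → DifferentiableAt ℝ Γ₂ s := hd₂.mono fun s h hs => (h hs).1
  have hl₁ := ae_lengthElement_eq_norm_deriv hL₁ hD₁
  have hl₂ := ae_lengthElement_eq_norm_deriv hL₂ hD₂
  have hlm := ae_lengthElement_eq_norm_deriv (lipschitzWith_midpoint hL₁ hL₂) (T := t₂) (by
    filter_upwards [hD₁, hD₂] with s h1 h2 hs using ((h1 hs).add (h2 hs)).const_smul (1 / 2 : ℝ))
  have hld := ae_lengthElement_eq_norm_deriv (hL₁.sub hL₂) (T := t₂) (by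
    filter_upwards [hD₁, hD₂] with s h1 h2 hs using (h1 hs).sub (h2 hs))
  have heqm : EqOn (fun t => (1 / 2 : ℝ) • (γ₁ t + γ₂ t)) (fun t => (1 / 2 : ℝ) • (Γ₁ t + Γ₂ t))
      (Icc 0 t₂) := fun s hs => by simp only [heq₁ hs, heq₂ hs]
  have heqd : EqOn (fun t => γ₁ t - γ₂ t) (fun t => Γ₁ t - Γ₂ t) (Icc 0 t₂) :=
    fun s hs => by simp only [heq₁ hs, heq₂ hs]
  have hm' : ∀ s ∈ Icc 0 t₂, 1 ≤ ‖(1 / 2 : ℝ) • (Γ₁ s + Γ₂ s)‖ := fun s hs => by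
    rw [← heq₁ hs, ← heq₂ hs]; exact (hm s hs).1
  have hn₁' : ∀ s ∈ Icc 0 t₂, 1 ≤ ‖Γ₁ s‖ ∧ ‖Γ₁ s‖ ≤ 2 := fun s hs => heq₁ hs ▸ hn₁ s hs
  have hn₂' : ∀ s ∈ Icc 0 t₂, 1 ≤ ‖Γ₂ s‖ ∧ ‖Γ₂ s‖ ≤ 2 := fun s hs => heq₂ hs ▸ hn₂ s hs
  simp only [qhLength, boundaryDist_compl_zero] at hR ⊢
  have hB₁ : ∫⁻ s in Icc 0 t₁, ENNReal.ofReal (lengthElement γ₁ s) / ENNReal.ofReal ‖γ₁ s‖ =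
      ∫⁻ s in Icc 0 t₁, ENNReal.ofReal (1 / ‖Γ₁ s‖) := by
    refine lintegral_congr_ae (ae_Icc_of_ae_Ioo ?_)
    filter_upwards [hd₁, hl₁] with s h1 h2 hs
    have hs' : s ∈ Ioo 0 t₂ := ⟨hs.1, hs.2.trans_le ht₁₂⟩
    rw [lengthElement_congr heq₁ hs', h2 hs', (h1 hs).2, heq₁ (Ioo_subset_Icc_self hs'),
      ofReal_div_ofReal_norm (hn₁' s (Ioo_subset_Icc_self hs')).1]
  have hB₂ : ∀ a b, 0 ≤ a → b ≤ t₂ →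
      ∫⁻ s in Icc a b, ENNReal.ofReal (lengthElement γ₂ s) / ENNReal.ofReal ‖γ₂ s‖ =
      ∫⁻ s in Icc a b, ENNReal.ofReal (1 / ‖Γ₂ s‖) := by
    intro a b ha hb
    refine lintegral_congr_ae (ae_Icc_of_ae_Ioo ?_)
    filter_upwards [hd₂, hl₂] with s h1 h2 hs
    have hs' : s ∈ Ioo 0 t₂ := ⟨ha.trans_lt hs.1, hs.2.trans_le hb⟩
    rw [lengthElement_congr heq₂ hs', h2 hs', (h1 hs').2, heq₂ (Ioo_subset_Icc_self hs'),
      ofReal_div_ofReal_norm (hn₂' s (Ioo_subset_Icc_self hs')).1]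
  have hA : ∀ a b, 0 ≤ a → b ≤ t₂ →
      ∫⁻ s in Icc a b, ENNReal.ofReal (lengthElement (fun t => (1 / 2 : ℝ) • (γ₁ t + γ₂ t)) s) /
        ENNReal.ofReal ‖(1 / 2 : ℝ) • (γ₁ s + γ₂ s)‖ =
      ∫⁻ s in Icc a b, ENNReal.ofReal (‖deriv (fun r => (1 / 2 : ℝ) • (Γ₁ r + Γ₂ r)) s‖ /
        ‖(1 / 2 : ℝ) • (Γ₁ s + Γ₂ s)‖) := by
    intro a b ha hb
    refine lintegral_congr_ae (ae_Icc_of_ae_Ioo ?_)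
    filter_upwards [hlm] with s h2 hs
    have hs' : s ∈ Ioo 0 t₂ := ⟨ha.trans_lt hs.1, hs.2.trans_le hb⟩
    have hsI := Ioo_subset_Icc_self hs'
    rw [lengthElement_congr heqm hs', h2 hs', heq₁ hsI, heq₂ hsI,
      ofReal_div_ofReal_norm (hm' s hsI)]
  have hδ : ∫⁻ s in Icc 0 t₁, ENNReal.ofReal
        (modulusOfConvexity X (lengthElement (fun t => γ₁ t - γ₂ t) s) / (‖γ₁ s‖ + ‖γ₂ s‖)) =
      ∫⁻ s in Icc 0 t₁, ENNReal.ofReal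
        (modulusOfConvexity X ‖deriv (fun r => Γ₁ r - Γ₂ r) s‖ / (‖Γ₁ s‖ + ‖Γ₂ s‖)) := by
    refine lintegral_congr_ae (ae_Icc_of_ae_Ioo ?_)
    filter_upwards [hld] with s h2 hs
    have hs' : s ∈ Ioo 0 t₂ := ⟨hs.1, hs.2.trans_le ht₁₂⟩
    have hsI := Ioo_subset_Icc_self hs'
    rw [lengthElement_congr heqd hs', h2 hs', heq₁ hsI, heq₂ hsI]
  have hKM : K * t₁ ^ 2 ≤ M := by
    have h1 : ENNReal.ofReal (t₁ / 2) ≤ ENNReal.ofReal (√(M / K) / 2) := by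
      calc ENNReal.ofReal (t₁ / 2) = ∫⁻ _ in Icc 0 t₁, ENNReal.ofReal (1 / 2) := by
            rw [setLIntegral_const, Real.volume_Icc, sub_zero,
              ← ENNReal.ofReal_mul (by norm_num)]
            congr 1; ring
        _ ≤ ∫⁻ s in Icc 0 t₁, ENNReal.ofReal (1 / ‖Γ₁ s‖) := by
            refine setLIntegral_mono' measurableSet_Icc fun s hs => ENNReal.ofReal_le_ofReal ?_
            have := hn₁' s ⟨hs.1, hs.2.trans ht₁₂⟩
            exact one_div_le_one_div_of_le (by linarith) this.2
        _ ≤ _ := by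
            rw [← hB₁]
            exact (lintegral_mono_set (Icc_subset_Icc_right ht₁₂)).trans
              ((le_max_left _ _).trans hR)
    rw [ENNReal.ofReal_le_ofReal_iff (by positivity)] at h1
    have h2 : t₁ ^ 2 ≤ M / K := by
      rw [← Real.le_sqrt ht₁ (by positivity)]
      linarith
    rwa [le_div_iff₀ hK0, mul_comm] at h2
  have hI : Icc 0 t₁ ⊆ Icc 0 t₂ := Icc_subset_Icc_right ht₁₂
  have main := lintegral_midpoint_add_modulus_le hK0 hM0 hK hM hL₁ hL₂ ht₁ hKM
    (by rw [← heq₁ (left_mem_Icc.2 ht₂), ← heq₂ (left_mem_Icc.2 ht₂), h0]) hd₁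
    (hd₂.mono fun s h hs => h ⟨hs.1, hs.2.trans_le ht₁₂⟩)
    (fun s hs => hn₁' s (hI hs)) (fun s hs => hn₂' s (hI hs)) (fun s hs => hm' s (hI hs))
  -- Here the midpoint moves at speed `1/2` and has norm at least `1`, so its density is at most
  -- `1/2 ≤ 1 / ‖Γ₂ s‖`. This bound splits into half the density of `γ₂` plus the extra integrand.
  have htail : ∫⁻ s in Icc t₁ t₂, ENNReal.ofReal
        (‖deriv (fun r => (1 / 2 : ℝ) • (Γ₁ r + Γ₂ r)) s‖ / ‖(1 / 2 : ℝ) • (Γ₁ s + Γ₂ s)‖) ≤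
      (∫⁻ s in Icc t₁ t₂, ENNReal.ofReal (1 / ‖Γ₂ s‖)) / 2 +
        ∫⁻ s in Icc t₁ t₂, ENNReal.ofReal (lengthElement γ₂ s) /
            (2 * ENNReal.ofReal ‖γ₂ s‖) := by
    have hc₂ := hL₂.continuous
    have hcm : Measurable fun s => ENNReal.ofReal (1 / ‖Γ₂ s‖) / 2 :=
      ((hc₂.norm.measurable.const_div 1).ennreal_ofReal).div_const 2
    have hhalf : (∫⁻ s in Icc t₁ t₂, ENNReal.ofReal (1 / ‖Γ₂ s‖)) / 2 =
        ∫⁻ s in Icc t₁ t₂, ENNReal.ofReal (1 / ‖Γ₂ s‖) / 2 := by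
      simp only [div_eq_mul_inv _ (2 : ℝ≥0∞)]
      rw [lintegral_mul_const _ ((hc₂.norm.measurable.const_div 1).ennreal_ofReal)]
    rw [hhalf, ← lintegral_add_left hcm]
    refine lintegral_mono_ae (ae_Icc_of_ae_Ioo ?_)
    filter_upwards [hd₂, hl₂] with s h1 h2 hs
    have hs' : s ∈ Ioo 0 t₂ := ⟨ht₁.trans_lt hs.1, hs.2⟩
    have hsI := Ioo_subset_Icc_self hs'
    have hq := hn₂' s hsI
    have hr := hm' s hsI
    have hdm : deriv (fun r => (1 / 2 : ℝ) • (Γ₁ r + Γ₂ r)) s = (1 / 2 : ℝ) • (0 + deriv Γ₂ s) :=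
      (((hz₁ s hs.1).add (h1 hs').1.hasDerivAt).const_smul (1 / 2 : ℝ)).deriv
    have hq0 : 0 < ‖Γ₂ s‖ := by linarith
    rw [hdm, zero_add, norm_smul, (h1 hs').2, Real.norm_of_nonneg (by norm_num), mul_one,
      lengthElement_congr heq₂ hs', h2 hs', (h1 hs').2, heq₂ hsI, ← ENNReal.ofReal_ofNat 2,
      ← ENNReal.ofReal_mul (by norm_num), ← ENNReal.ofReal_div_of_pos (by norm_num),
      ← ENNReal.ofReal_div_of_pos (by positivity),
      ← ENNReal.ofReal_add (by positivity) (by positivity)]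
    refine ENNReal.ofReal_le_ofReal ?_
    calc 1 / 2 / ‖(1 / 2 : ℝ) • (Γ₁ s + Γ₂ s)‖ ≤ 1 / 2 := div_le_self (by norm_num) hr
      _ ≤ 1 / ‖Γ₂ s‖ := one_div_le_one_div_of_le hq0 hq.2
      _ = 1 / ‖Γ₂ s‖ / 2 + 1 / (2 * ‖Γ₂ s‖) := by field_simp; norm_num
  calc _ = (∫⁻ s in Icc 0 t₁, ENNReal.ofReal
        (‖deriv (fun r => (1 / 2 : ℝ) • (Γ₁ r + Γ₂ r)) s‖ / ‖(1 / 2 : ℝ) • (Γ₁ s + Γ₂ s)‖)) +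
      (∫⁻ s in Icc 0 t₁, ENNReal.ofReal
        (modulusOfConvexity X ‖deriv (fun r => Γ₁ r - Γ₂ r) s‖ / (‖Γ₁ s‖ + ‖Γ₂ s‖))) +
      ∫⁻ s in Icc t₁ t₂, ENNReal.ofReal
        (‖deriv (fun r => (1 / 2 : ℝ) • (Γ₁ r + Γ₂ r)) s‖ / ‖(1 / 2 : ℝ) • (Γ₁ s + Γ₂ s)‖) := by
        rw [hA 0 t₂ le_rfl le_rfl, hδ, setLIntegral_Icc_add_Icc _ ht₁ ht₁₂, add_right_comm]
    _ ≤ _ := add_le_add main htail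
    _ = ((∫⁻ s in Icc 0 t₁, ENNReal.ofReal (lengthElement γ₁ s) / ENNReal.ofReal ‖γ₁ s‖) +
          ∫⁻ s in Icc 0 t₂, ENNReal.ofReal (lengthElement γ₂ s) / ENNReal.ofReal ‖γ₂ s‖) / 2 +
        ∫⁻ s in Icc t₁ t₂, ENNReal.ofReal (lengthElement γ₂ s) /
            (2 * ENNReal.ofReal ‖γ₂ s‖) := by
        rw [← add_assoc, ← ENNReal.add_div, add_assoc (lintegral _ _), hB₁, hB₂ 0 t₂ le_rfl le_rfl,
          setLIntegral_Icc_add_Icc (fun s => ENNReal.ofReal (1 / ‖Γ₂ s‖)) ht₁ ht₁₂]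
    -- Only the domain of the `γ₁` integral grows, from `[0, t₁]` to `[0, t₂]`.
    _ ≤ _ := by
        gcongr
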